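/- **Setting.** Let $G=(A\cup B,E)$ be a finite bipartite graph ($A$ men, $B$ women). Every man $a$ has a strict preference order on his set of neighbours $N(a)$; every woman $b$ has a preference order with ties (a total preorder) on $N(b)$. Write $x>_c y$ if $c$ strictly prefers $x$ to $y$, $x\ge_c y$ if $c$ likes $x$ at least as much as $y$. A pair $(a,b)\in E\setminus N$ blocks a matching $N$ if each of $a$, $b$ is unmatched in $N$ or strictly prefers the other to the current partner; $N$ is stable if no pair blocks it. Let $\mathrm{OPT}$ be a stable matching of $G$ of maximum cardinality. **Algorithm (Huang–Telikepalli).** Each man has two proposals, both initially offered to the first woman on his list. When a proposal is rejected by the $k$-th woman on the list it goes to the $(k+1)$-st (after the last one, again to the first). Men start *basic*; a basic man becomes *1-promoted* once every woman in $N(a)$ has rejected a proposal of his; he becomes *2-promoted* once every woman in $N(a)$ has rejected a proposal of his as a 1-promoted man; he stops making proposals once every woman in $N(a)$ has rejected a proposal of his as a 2-promoted man. Men propose in arbitrary order. A woman holding at most one other proposal accepts the current one; if she already holds two, she rejects a least desirable one of the three, i.e. one that is not superior to any of them (ties broken arbitrarily). For $b$, a proposal of $a$ is superior to one of $a'$ if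 $a>_b a'$, or $b$ is indifferent between them and: $a$ is 2-promoted and $a'$ is not; or $a$ is 1-promoted and $a'$ basic; or both are basic, $b$ has already rejected a proposal of $a$ and none of $a'$. The phase ends when no proposal is left to be made. Let $G'$ be the simple graph on $A\cup B$ whose edges are the $(a,b)$ such that $b$ holds at least one proposal of $a$ at the end, and let $M$ be a maximum cardinality matching of $G'$ in which all nodes of degree 2 of $G'$ are matched. **The digraph $H$.** An *augmenting path* is an $M$-augmenting path $\alpha_0-\beta_0-\alpha_1-\dots-\alpha_k-\beta_k$ in $M\oplus\mathrm{OPT}$ with $\alpha_i\in A$, $\beta_i\in B$, $(\alpha_i,\beta_i)\in \mathrm{OPT}$, $(\alpha_{i+1},\beta_i)\in M$, and $\alpha_0,\beta_k$ unmatched by $M$; its length is its number of edges $2k+1$. Orient the edges of $G'$ from men to women and, for each augmenting path with $k\ge 1$, contract $(\alpha_1,\beta_0)$ into an *$x$-node* and $(\alpha_k,\beta_{k-1})$ into a *$y$-node*; all other nodes are *blue*. Let $[v]$ be the node of the resulting digraph $H$ corresponding to $v$. An arc $([a],[b])$ of $H$ ($a\in A$, $b\in B$) is *critical* if $b\ge_a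 \mathrm{OPT}(a)$, $a$ is not 2-promoted at the end, $(a,b)\notin M$ and $[a]$ is not a $y$-node; it is *next to* the woman $b'$ if $(a,b')\in\mathrm{OPT}$. **Jumps.** For a woman $b$ unmatched by $M$ and not isolated in $G'$, $\mathrm{mjump}(b)$ is the woman at the other end of the maximal undirected path of $G'$ with end $b$. For a $y$-node or an end $c$ of a critical arc, $\mathrm{pathjump}(c)$ is the blue woman reached from $c$ by a directed path of $H$ using no edge of $M$. For $b$ as above, $\mathrm{mjumpe}(b)$ is $\mathrm{mjump}(b)$ if the latter is blue, and $\mathrm{pathjump}([\mathrm{mjump}(b)])$ if $\mathrm{mjump}(b)$ is in a $y$-node. **Charging scheme.** (1) Each man in a $y$-node from an augmenting path of length 5 receives charge 1. (2) Each man with nonzero charge passes it to his less preferred neighbour in $G'$ (to his only neighbour if he has just one). (3) Each woman $b$ with nonzero charge who is unmatched by $M$ passes it to $\mathrm{mjump}(b)$. (4) Each woman next to whom there is a critical arc $([a],[c])$ passes all her charge to $\mathrm{pathjump}([a])$. (5) Each woman who received nonzero charge at stage 4 and is unmatched by $M$ passes all her charge to $\mathrm{mjumpe}$ of herself. The *unpopularity-charge*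 of a woman is the charge that she received at stages 2 and 3 and has not passed on by the end of the scheme. **Theorem.** For every instance, every run of the algorithm, every such $M$ and every such $\mathrm{OPT}$: if $\alpha_0-\beta_0-\dots-\alpha_k-\beta_k$ is an augmenting path of length at least $7$ (with $\alpha_i\in A$, $\beta_i\in B$), then there is an $i\in\{1,\dots,k-1\}$ such that the woman $\beta_i$ has zero unpopularity-charge at the end of the charging scheme. -/

import Mathlib

namespace OneSidedTies

/-! ### Instances -/

/-- An instance of stable marriage with incomplete lists and one-sided ties, men `A`, women `B`.
`menList a` lists the women acceptable to `a` in strictly decreasing order of preference; the pair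
`(a, b)` is an edge of the bipartite graph `G` when `b` is on the list of `a`. `womanGE b a a'` says
that `b` likes `a` at least as much as `a'`; it is a total preorder, so ties are allowed. (Only its
restriction to the neighbours of `b` is ever relevant, and every total preorder on the neighbours
of `b` extends to all of `A`.) -/
structure SMInstance (A B : Type*) where
  menList : A → List B
  menList_nodup : ∀ a, (menList a).Nodup
  womanGE : B → A → A → Prop
  womanGE_total : ∀ b a a', womanGE b a a' ∨ womanGE b a' a
  womanGE_trans : ∀ b a a' a'', womanGE b a a' → womanGE b a' a'' → womanGE b a a''

section

variable {A B : Type*} [DecidableEq A] [DecidableEq B]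

namespace SMInstance

variable (I : SMInstance A B)

/-- `(a, b)` is an edge of `G`. -/
def Edge (a : A) (b : B) : Prop := b ∈ I.menList a

/-- `b >_a b'`: man `a` strictly prefers `b` to `b'` (both acceptable to him). -/
def ManPrefers (a : A) (b b' : B) : Prop :=
  I.Edge a b ∧ I.Edge a b' ∧ (I.menList a).idxOf b < (I.menList a).idxOf b'

/-- `b ≥_a b'`. -/
def ManGE (a : A) (b b' : B) : Prop := b = b' ∨ I.ManPrefers a b b'

/-- `a >_b a'`: woman `b` strictly prefers `a` to `a'`. -/
def WomanPrefers (b : B) (a a' : A) : Prop := I.womanGE b a a' ∧ ¬ I.womanGE b a' a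

/-- Woman `b` is indifferent between `a` and `a'`. -/
def WomanIndiff (b : B) (a a' : A) : Prop := I.womanGE b a a' ∧ I.womanGE b a' a

end SMInstance

/-! ### Matchings and stability -/

/-- A set of man-woman pairs is a matching if no person occurs in two of its pairs. -/
def IsMatching (M : Finset (A × B)) : Prop :=
  (∀ a b b', (a, b) ∈ M → (a, b') ∈ M → b = b') ∧
  (∀ a a' b, (a, b) ∈ M → (a', b) ∈ M → a = a')

/-- Man `a` is matched by `M`. -/
def ManMatched (M : Finset (A × B)) (a : A) : Prop := ∃ b, (a, b) ∈ M

/-- Woman `b` is matched by `M`. -/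
def WomanMatched (M : Finset (A × B)) (b : B) : Prop := ∃ a, (a, b) ∈ M

/-- `(a, b)` is a blocking pair for the matching `M`: an edge of `G` outside `M` such that each of
`a`, `b` is unmatched or prefers the other one to the current partner. -/
def SMInstance.Blocks (I : SMInstance A B) (M : Finset (A × B)) (a : A) (b : B) : Prop :=
  I.Edge a b ∧ (a, b) ∉ M ∧
  (¬ ManMatched M a ∨ ∃ b', (a, b') ∈ M ∧ I.ManPrefers a b b') ∧
  (¬ WomanMatched M b ∨ ∃ a', (a', b) ∈ M ∧ I.WomanPrefers b a a')

/-- `M` is a stable matching in `G`. -/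
def SMInstance.IsStable (I : SMInstance A B) (M : Finset (A × B)) : Prop :=
  IsMatching M ∧ (∀ a b, (a, b) ∈ M → I.Edge a b) ∧ ∀ a b, ¬ I.Blocks M a b

/-- `M` is a stable matching in `G` of maximum cardinality. -/
def SMInstance.IsMaxStable (I : SMInstance A B) (M : Finset (A × B)) : Prop :=
  I.IsStable M ∧ ∀ N, I.IsStable N → N.card ≤ M.card

/-! ### The proposal algorithm -/

/-- The status of a man. -/
inductive Status
  | basic
  | onePromoted
  | twoPromoted

/-- A state of the algorithm. The two proposals of `a` are `(a, 0)` and `(a, 1)`.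
* `pos p`: the index, in the list of the man who owns `p`, of the woman to whom `p` is offered;
* `held b`: the proposals currently held by `b`;
* `status a`: the current status of `a`;
* `rejectedAs a b t`: so far, `b` rejected a proposal of `a` at a moment when `a` had status `t`. -/
structure AlgState (A B : Type*) where
  pos : A × Fin 2 → ℕ
  held : B → Finset (A × Fin 2)
  status : A → Status
  rejectedAs : A → B → Status → Prop

/-- The initial state: all men are basic and all proposals are offered to the first woman. -/
def initState (A B : Type*) : AlgState A B where
  pos := fun _ => 0
  held := fun _ => ∅
  status := fun _ => Status.basic
  rejectedAs := fun _ _ _ => False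

/-- So far, `b` rejected some proposal of `a`. -/
def AlgState.Rejected (s : AlgState A B) (b : B) (a : A) : Prop := ∃ t, s.rejectedAs a b t

namespace SMInstance

variable (I : SMInstance A B)

/-- The woman to whom the proposal `p` is currently offered (`none` if the list is empty). -/
def target (s : AlgState A B) (p : A × Fin 2) : Option B := (I.menList p.1)[s.pos p]?

/-- Man `a` has stopped making proposals: he is 2-promoted and every woman in `N(a)` rejected him
as a 2-promoted man. -/
def Stopped (s : AlgState A B) (a : A) : Prop :=
  s.status a = Status.twoPromoted ∧ ∀ b, I.Edge a b → s.rejectedAs a b Status.twoPromoted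

/-- From the point of view of `b`, a proposal of `a` is superior to a proposal of `a'`. -/
def Superior (s : AlgState A B) (b : B) (a a' : A) : Prop :=
  I.WomanPrefers b a a' ∨
  (I.WomanIndiff b a a' ∧ s.status a = Status.twoPromoted ∧ s.status a' ≠ Status.twoPromoted) ∨
  (I.WomanIndiff b a a' ∧ s.status a = Status.onePromoted ∧ s.status a' = Status.basic) ∨
  (I.WomanIndiff b a a' ∧ s.status a = Status.basic ∧ s.status a' = Status.basic ∧
    s.Rejected b a ∧ ¬ s.Rejected b a')

/-- `q` is a least desirable proposal in `S` for `b`: it is superior to no proposal in `S`. -/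
def LeastDesirable (s : AlgState A B) (b : B) (S : Finset (A × Fin 2)) (q : A × Fin 2) : Prop :=
  q ∈ S ∧ ∀ r ∈ S, ¬ I.Superior s b q.1 r.1

open Classical in
/-- The status of `a` after a rejection, given his status `t` before it and the updated record. -/
noncomputable def nextStatus (rejectedAs : A → B → Status → Prop) (a : A) (t : Status) : Status :=
  match t with
  | Status.basic =>
      if ∀ b, I.Edge a b → rejectedAs a b Status.basic then Status.onePromoted else Status.basic
  | Status.onePromoted =>
      if ∀ b, I.Edge a b → rejectedAs a b Status.onePromoted then Status.twoPromoted
      else Status.onePromoted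
  | Status.twoPromoted => Status.twoPromoted

/-- The record of rejections after `b` rejected a proposal of `a`. -/
def recordRejection (s : AlgState A B) (b : B) (a : A) : A → B → Status → Prop :=
  fun a' b' t => s.rejectedAs a' b' t ∨ (a' = a ∧ b' = b ∧ t = s.status a)

/-- The state after `b`, who already held two proposals and received the proposal `p`, rejects `q`
among these three: `q` moves on to the next woman, cyclically. -/
noncomputable def rejectState (s : AlgState A B) (b : B) (p q : A × Fin 2) : AlgState A B where
  pos := Function.update s.pos q ((s.pos q + 1) % (I.menList q.1).length)
  held := Function.update s.held b ((insert p (s.held b)).erase q)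
  status := Function.update s.status q.1
    (I.nextStatus (recordRejection s b q.1) q.1 (s.status q.1))
  rejectedAs := recordRejection s b q.1

/-- The state after `b` accepts the proposal `p`, rejecting nothing. -/
def acceptState (s : AlgState A B) (b : B) (p : A × Fin 2) : AlgState A B :=
  { s with held := Function.update s.held b (insert p (s.held b)) }

/-- One step of the proposal phase: some man who has not stopped makes one of his proposals that
is not currently held. The choice of the proposal, and of the least desirable proposal if there
are several, is arbitrary. -/
inductive Step : AlgState A B → AlgState A B → Prop
  | accept (s : AlgState A B) (p : A × Fin 2) (b : B) :
      ¬ I.Stopped s p.1 → I.target s p = some b → p ∉ s.held b → (s.held b).card ≤ 1 →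
      Step s (acceptState s b p)
  | reject (s : AlgState A B) (p q : A × Fin 2) (b : B) :
      ¬ I.Stopped s p.1 → I.target s p = some b → p ∉ s.held b → 2 ≤ (s.held b).card →
      I.LeastDesirable s b (insert p (s.held b)) q →
      Step s (I.rejectState s b p q)

/-- `s` is the state at the end of some run of the proposal phase. -/
def IsFinal (s : AlgState A B) : Prop :=
  Relation.ReflTransGen I.Step (initState A B) s ∧ ∀ s', ¬ I.Step s s'

end SMInstance

/-! ### The graph `G'` and the output matching -/

/-- `(a, b)` is an edge of `G'`: `b` holds at least one proposal of `a`. -/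
def AlgState.GEdge (s : AlgState A B) (a : A) (b : B) : Prop := ∃ i, (a, i) ∈ s.held b

/-- The simple bipartite graph `G'` on the node set `A ∪ B`. -/
def AlgState.graph (s : AlgState A B) : SimpleGraph (A ⊕ B) where
  Adj v w := (∃ a b, v = Sum.inl a ∧ w = Sum.inr b ∧ s.GEdge a b) ∨
    (∃ a b, w = Sum.inl a ∧ v = Sum.inr b ∧ s.GEdge a b)
  symm := ⟨fun _ _ h => h.symm⟩
  loopless := ⟨by rintro v (⟨a, b, h, h', -⟩ | ⟨a, b, h, h', -⟩) <;> simp [h] at h'⟩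

/-- `M` is a possible output: a matching in `G'`, of maximum cardinality among the matchings in
`G'`, that matches all nodes of degree two in `G'`. -/
def IsOutput (s : AlgState A B) (M : Finset (A × B)) : Prop :=
  (IsMatching M ∧ ∀ a b, (a, b) ∈ M → s.GEdge a b) ∧
  (∀ N : Finset (A × B), IsMatching N → (∀ a b, (a, b) ∈ N → s.GEdge a b) → N.card ≤ M.card) ∧
  (∀ a, (s.graph.neighborSet (Sum.inl a)).ncard = 2 → ManMatched M a) ∧
  (∀ b, (s.graph.neighborSet (Sum.inr b)).ncard = 2 → WomanMatched M b)

/-! ### Augmenting paths -/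

/-- `α 0 - β 0 - α 1 - β 1 - ⋯ - α k - β k` is an `M`-augmenting path (with `2 * k + 1` edges) in
the symmetric difference of `M` and `OPT`. Only the values at indices `≤ k` matter. -/
structure IsAugPath (M OPT : Finset (A × B)) (k : ℕ) (α : ℕ → A) (β : ℕ → B) : Prop where
  injOn_man : Set.InjOn α (Set.Iic k)
  injOn_woman : Set.InjOn β (Set.Iic k)
  opt_edge : ∀ i ≤ k, (α i, β i) ∈ OPT ∧ (α i, β i) ∉ M
  m_edge : ∀ i < k, (α (i + 1), β i) ∈ M ∧ (α (i + 1), β i) ∉ OPT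
  first_unmatched : ¬ ManMatched M (α 0)
  last_unmatched : ¬ WomanMatched M (β k)

/-! ### The digraph `H` -/

/-- `(a, b)` is the edge `(α₁, β₀)` of some augmenting path. -/
def XEdge (M OPT : Finset (A × B)) (a : A) (b : B) : Prop :=
  ∃ k α β, 1 ≤ k ∧ IsAugPath M OPT k α β ∧ a = α 1 ∧ b = β 0

/-- `(a, b)` is the edge `(α_k, β_{k-1})` of some augmenting path. -/
def YEdge (M OPT : Finset (A × B)) (a : A) (b : B) : Prop :=
  ∃ k α β, 1 ≤ k ∧ IsAugPath M OPT k α β ∧ a = α k ∧ b = β (k - 1)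

/-- The edge `(a, b)` gets contracted in the construction of `H`. -/
def Contracted (M OPT : Finset (A × B)) (a : A) (b : B) : Prop := XEdge M OPT a b ∨ YEdge M OPT a b

/-- The node `[v]` of `H` corresponding to `v ∈ A ∪ B`, as the set of all nodes identified with `v`
(the contracted edges belong to the matching `M`, so they are pairwise disjoint). -/
def node (M OPT : Finset (A × B)) : A ⊕ B → Set (A ⊕ B)
  | Sum.inl a => {v | v = Sum.inl a ∨ ∃ b, v = Sum.inr b ∧ Contracted M OPT a b}
  | Sum.inr b => {v | v = Sum.inr b ∨ ∃ a, v = Sum.inl a ∧ Contracted M OPT a b}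

/-- `X` is an `x`-node of `H`. -/
def IsXNode (M OPT : Finset (A × B)) (X : Set (A ⊕ B)) : Prop :=
  ∃ a b, XEdge M OPT a b ∧ X = {Sum.inl a, Sum.inr b}

/-- `X` is a `y`-node of `H`. -/
def IsYNode (M OPT : Finset (A × B)) (X : Set (A ⊕ B)) : Prop :=
  ∃ a b, YEdge M OPT a b ∧ X = {Sum.inl a, Sum.inr b}

/-- The woman `b` is blue, i.e. `[b]` is neither an `x`-node nor a `y`-node. -/
def BlueWoman (M OPT : Finset (A × B)) (b : B) : Prop :=
  ¬ IsXNode M OPT (node M OPT (Sum.inr b)) ∧ ¬ IsYNode M OPT (node M OPT (Sum.inr b))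

/-- The arcs of `H`: the edges of `G'` that are not contracted, directed from men to women. -/
def HArc (s : AlgState A B) (M OPT : Finset (A × B)) (X Y : Set (A ⊕ B)) : Prop :=
  ∃ a b, s.GEdge a b ∧ ¬ Contracted M OPT a b ∧
    X = node M OPT (Sum.inl a) ∧ Y = node M OPT (Sum.inr b)

/-- The arcs of `H` that are not in `M`. -/
def HArcOutside (s : AlgState A B) (M OPT : Finset (A × B)) (X Y : Set (A ⊕ B)) : Prop :=
  ∃ a b, s.GEdge a b ∧ ¬ Contracted M OPT a b ∧ (a, b) ∉ M ∧
    X = node M OPT (Sum.inl a) ∧ Y = node M OPT (Sum.inr b)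

/-- The pair `([a], [b])` is a critical arc of `H`. -/
def IsCritical (I : SMInstance A B) (s : AlgState A B) (M OPT : Finset (A × B))
    (a : A) (b : B) : Prop :=
  HArc s M OPT (node M OPT (Sum.inl a)) (node M OPT (Sum.inr b)) ∧
  (∀ b', (a, b') ∈ OPT → I.ManGE a b b') ∧
  s.status a ≠ Status.twoPromoted ∧
  (a, b) ∉ M ∧
  ¬ IsYNode M OPT (node M OPT (Sum.inl a))

/-- The critical arc `([a], [c])` is next to the woman `b`. -/
def CriticalNextTo (I : SMInstance A B) (s : AlgState A B) (M OPT : Finset (A × B))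
    (a : A) (c b : B) : Prop :=
  IsCritical I s M OPT a c ∧ (a, b) ∈ OPT

/-! ### Jumps -/

/-- `c` is the matching jump of `b`: `b` is unmatched by `M` and not isolated in `G'`, and `b`, `c`
are the end nodes of a maximal path in `G'`, i.e. a path that cannot be extended at either end. -/
def MJump (s : AlgState A B) (M : Finset (A × B)) (b c : B) : Prop :=
  ¬ WomanMatched M b ∧ (∃ a, s.GEdge a b) ∧
  ∃ p : s.graph.Walk (Sum.inr b) (Sum.inr c), p.IsPath ∧
    (∀ v, s.graph.Adj (Sum.inr b) v → v ∈ p.support) ∧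
    (∀ v, s.graph.Adj (Sum.inr c) v → v ∈ p.support)

/-- `b` is the path jump of the node `X` of `H`: `X` is a `y`-node or an end node of a critical arc,
`b` is a blue woman, and a directed path in `H` using no edge of `M` leads from `X` to `b`. -/
def PathJump (I : SMInstance A B) (s : AlgState A B) (M OPT : Finset (A × B))
    (X : Set (A ⊕ B)) (b : B) : Prop :=
  (IsYNode M OPT X ∨ ∃ a c, IsCritical I s M OPT a c ∧
    (X = node M OPT (Sum.inl a) ∨ X = node M OPT (Sum.inr c))) ∧
  BlueWoman M OPT b ∧
  Relation.ReflTransGen (HArcOutside s M OPT) X (node M OPT (Sum.inr b))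

/-- `c` is the matching jump with exception of `b`. -/
def MJumpE (I : SMInstance A B) (s : AlgState A B) (M OPT : Finset (A × B)) (b c : B) : Prop :=
  ∃ d, MJump s M b d ∧
    ((BlueWoman M OPT d ∧ c = d) ∨
     (IsYNode M OPT (node M OPT (Sum.inr d)) ∧
      PathJump I s M OPT (node M OPT (Sum.inr d)) c))

/-- `b` is the less preferred neighbour of `a` in `G'` (his only neighbour if he has just one). -/
def LessPreferredNeighbor (I : SMInstance A B) (s : AlgState A B) (a : A) (b : B) : Prop :=
  s.GEdge a b ∧ ∀ b', s.GEdge a b' → I.ManGE a b' b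

/-! ### The charging scheme -/

section Charging

variable [Fintype A] [Fintype B]
variable (I : SMInstance A B) (s : AlgState A B) (M OPT : Finset (A × B))

open Classical in
/-- Stage 1: each man in a `y`-node from an augmenting path with 5 edges receives charge 1. -/
noncomputable def charge1 (a : A) : ℕ :=
  if ∃ α β, IsAugPath M OPT 2 α β ∧ a = α 2 then 1 else 0

open Classical in
/-- The charge of `b` after stage 2: each man passes on his charge to his less preferred
neighbour in `G'`. -/
noncomputable def charge2 (b : B) : ℕ :=
  ∑ a with LessPreferredNeighbor I s a b, charge1 M OPT a

open Classical in
/-- The charge of `c` after stage 3: each woman not matched by `M` passes on her charge to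
her matching jump. -/
noncomputable def charge3 (c : B) : ℕ :=
  (if WomanMatched M c then charge2 I s M OPT c else 0) +
    ∑ b with (¬ WomanMatched M b ∧ MJump s M b c), charge2 I s M OPT b

open Classical in
/-- The unpopularity-charge (received at stages 2 and 3) that `b` still has after stage 4, in which
each woman next to whom there is a critical arc passes on all her charge. -/
noncomputable def unpop4 (b : B) : ℕ :=
  if ∃ a d, CriticalNextTo I s M OPT a d b then 0 else charge3 I s M OPT b

open Classical in
/-- The path-charge that `c` receives at stage 4: a woman `b` next to whom there is a critical
arc `([a], [d])` passes on her charge to the path jump of `[a]`. -/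
noncomputable def path4 (c : B) : ℕ :=
  ∑ b with (∃ a d, CriticalNextTo I s M OPT a d b ∧
    PathJump I s M OPT (node M OPT (Sum.inl a)) c), charge3 I s M OPT b

/-- The women who pass on their charge at stage 5. -/
def PassesAt5 (b : B) : Prop := path4 I s M OPT b ≠ 0 ∧ ¬ WomanMatched M b

open Classical in
/-- The unpopularity-charge of `b` at the end of the charging scheme (after stage 5). -/
noncomputable def unpopularityCharge (b : B) : ℕ :=
  if PassesAt5 I s M OPT b then 0 else unpop4 I s M OPT b

open Classical in
/-- The path-charge (received at stages 4 and 5) of `c` at the end of the charging scheme: at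
stage 5, the women concerned pass on all their charge to their matching jump with exception. -/
noncomputable def pathCharge (c : B) : ℕ :=
  (if PassesAt5 I s M OPT c then 0 else path4 I s M OPT c) +
    ∑ b with (PassesAt5 I s M OPT b ∧ MJumpE I s M OPT b c),
      (path4 I s M OPT b + unpop4 I s M OPT b)

end Charging

end

end OneSidedTies

open OneSidedTies

/-!
The index `i = 1` always works. The woman `β 1` is matched by `M`, so she keeps unpopularity-charge
only if she received some in stages 2 and 3 and no critical arc is next to her
(`unpopularityCharge_ne_zero`). Suppose that both are the case.

Two facts about the end of the proposal phase are behind everything. First, a man unmatched by `M`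
has been rejected as a 2-promoted man by all women on his list. Hence `β 0` strictly prefers her
`M`-partner `α 1` to `α 0` unless `α 1` is 2-promoted, and then stability of `OPT` forces `α 1` to
prefer `β 1` to `β 0` (`manPrefers_of_isAugPath`). Since no critical arc is next to `β 1`, all
proposals of `α 1` are at women he likes strictly less than `β 1`, unless he is 2-promoted.
Secondly, a woman holding at most one proposal has never rejected anybody.

If charge reached `β 1` by a matching jump, then she holds one proposal only, so `α 1` still has his
proposals at women he likes at least as much as `β 1`: a contradiction (`not_mJump`). Otherwise she
is the less preferred neighbour of the last man `a` of an augmenting path. The `OPT`-partner of `a`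
is unmatched by `M` and has rejected nobody, so `a` is basic and prefers `β 1` to his `OPT`-partner;
also, `β 1` has never rejected `a`. By stability of `OPT`, `β 1` likes `α 1` at least as much as
`a`. Now either `α 1` is 2-promoted and was rejected by `β 1` as a 1-promoted man, or both his proposals
have passed `β 1`, which means that she has rejected him as a promoted man or at a moment when she
had already rejected his other proposal. Each of these rejections is incompatible with her holding
the proposal of the never rejected basic man `a` (`not_lessPreferredNeighbor`).

The last incompatibility is an invariant of the algorithm: a rejection by `b` of a proposal of `a`
bounds from below the desirability of everything that `b` holds from then on. To express it,
`AlgState.rank` turns the rules for breaking ties into a number. The invariants are collected in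
`Inv`.
-/

set_option linter.unusedSectionVars false

namespace OneSidedTies

variable {A B : Type*} [DecidableEq A] [DecidableEq B]

/-! ### Ranking tied proposals -/

open Classical in
/-- The rank by which `b` compares proposals of men between whom she is indifferent: `2` for
1-promoted and `3` for 2-promoted men; a basic man has rank `1` or `0` according to whether `b`
has already rejected a proposal of his. -/
noncomputable def AlgState.rank (s : AlgState A B) (b : B) (a : A) : ℕ :=
  match s.status a with
  | Status.basic => if s.Rejected b a then 1 else 0
  | Status.onePromoted => 2
  | Status.twoPromoted => 3

lemma AlgState.two_le_rank {s : AlgState A B} {b : B} {a : A} :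
    2 ≤ s.rank b a ↔ s.status a ≠ Status.basic := by
  unfold AlgState.rank
  cases s.status a <;> simp
  split_ifs <;> simp

lemma AlgState.three_le_rank {s : AlgState A B} {b : B} {a : A} :
    3 ≤ s.rank b a ↔ s.status a = Status.twoPromoted := by
  unfold AlgState.rank
  cases s.status a <;> simp
  split_ifs <;> simp

lemma AlgState.one_le_rank_of_rejected {s : AlgState A B} {b : B} {a : A} (h : s.Rejected b a) :
    1 ≤ s.rank b a := by
  unfold AlgState.rank
  cases s.status a <;> simp [h]

lemma AlgState.rejected_of_one_le_rank {s : AlgState A B} {b : B} {a : A}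
    (hs : s.status a = Status.basic) (h : 1 ≤ s.rank b a) : s.Rejected b a := by
  unfold AlgState.rank at h
  rw [hs] at h
  by_contra hc
  simp [hc] at h

namespace SMInstance

variable (I : SMInstance A B)

lemma superior_iff (s : AlgState A B) (b : B) (a a' : A) :
    I.Superior s b a a' ↔
      I.WomanPrefers b a a' ∨ (I.WomanIndiff b a a' ∧ s.rank b a' < s.rank b a) := by
  unfold Superior AlgState.rank
  cases h : s.status a <;> cases h' : s.status a' <;> simp <;>
    by_cases hr : s.Rejected b a <;> by_cases hr' : s.Rejected b a' <;> simp [hr, hr']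

/-- A proposal is not superior to another one exactly if it is at most as desirable in the
lexicographic combination of the preferences of `b` with the rank, which is a total preorder. -/
lemma not_superior_iff (s : AlgState A B) (b : B) (a a' : A) :
    ¬ I.Superior s b a a' ↔
      (I.womanGE b a a' → I.womanGE b a' a ∧ s.rank b a ≤ s.rank b a') := by
  rw [superior_iff]
  unfold WomanPrefers WomanIndiff
  grind

lemma not_superior_trans {s : AlgState A B} {b : B} {a a' a'' : A}
    (h : ¬ I.Superior s b a a') (h' : ¬ I.Superior s b a' a'') : ¬ I.Superior s b a a'' := by
  rw [not_superior_iff] at *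
  intro hge
  rcases I.womanGE_total b a a' with h1 | h1
  · obtain ⟨h2, h3⟩ := h h1
    obtain ⟨h4, h5⟩ := h' (I.womanGE_trans b _ _ _ h2 hge)
    exact ⟨I.womanGE_trans b _ _ _ h4 h2, h3.trans h5⟩
  · obtain ⟨h4, h5⟩ := h' (I.womanGE_trans b _ _ _ h1 hge)
    obtain ⟨h2, h3⟩ := h (I.womanGE_trans b _ _ _ hge h4)
    exact ⟨I.womanGE_trans b _ _ _ h4 h2, h3.trans h5⟩

/-- Without this, the phase could get stuck with a woman facing three proposals and unable to
reject one of them. -/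
lemma exists_leastDesirable (s : AlgState A B) (b : B) (S : Finset (A × Fin 2))
    (hS : S.Nonempty) : ∃ q, I.LeastDesirable s b S q := by
  induction hS using Finset.Nonempty.cons_induction with
  | singleton a =>
    refine ⟨a, by simp, fun r hr => ?_⟩
    rw [Finset.mem_singleton] at hr
    subst hr
    rw [not_superior_iff]
    exact fun h => ⟨h, le_rfl⟩
  | cons x T hx hT ih =>
    obtain ⟨q, hq, hmin⟩ := ih
    by_cases hsup : I.Superior s b q.1 x.1
    · have hxq : ¬ I.Superior s b x.1 q.1 := by
        rw [superior_iff] at *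
        unfold WomanPrefers WomanIndiff at *
        grind
      refine ⟨x, by simp, fun r hr => ?_⟩
      rw [Finset.mem_cons] at hr
      rcases hr with rfl | hr
      · rw [not_superior_iff]
        exact fun h => ⟨h, le_rfl⟩
      · exact I.not_superior_trans hxq (hmin r hr)
    · refine ⟨q, by simp [hq], fun r hr => ?_⟩
      rw [Finset.mem_cons] at hr
      rcases hr with rfl | hr
      · exact hsup
      · exact hmin r hr

/-- All proposals held by `b` are at least as desirable for her as a proposal of `a` of rank `n`
would be. A rejection of a proposal establishes such a lower bound, and once `b` holds two
proposals the bound persists for the rest of the run (see `AtLeast.reject`). -/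
def AtLeast (s : AlgState A B) (b : B) (a : A) (n : ℕ) : Prop :=
  ∀ r ∈ s.held b, I.womanGE b a r.1 → I.womanGE b r.1 a ∧ n ≤ s.rank b r.1

/-! ### Effect of a rejection -/

lemma nextStatus_eq_twoPromoted (R : A → B → Status → Prop) (a : A) (t : Status) :
    I.nextStatus R a t = Status.twoPromoted ↔ t = Status.twoPromoted ∨
      (t = Status.onePromoted ∧ ∀ b, I.Edge a b → R a b Status.onePromoted) := by
  cases t <;> simp [nextStatus]
  grind

lemma nextStatus_eq_onePromoted (R : A → B → Status → Prop) (a : A) (t : Status) :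
    I.nextStatus R a t = Status.onePromoted ↔
      (t = Status.basic ∧ ∀ b, I.Edge a b → R a b Status.basic) ∨
      (t = Status.onePromoted ∧ ¬ ∀ b, I.Edge a b → R a b Status.onePromoted) := by
  cases t <;> simp [nextStatus]

lemma nextStatus_eq_basic (R : A → B → Status → Prop) (a : A) (t : Status) :
    I.nextStatus R a t = Status.basic ↔
      (t = Status.basic ∧ ¬ ∀ b, I.Edge a b → R a b Status.basic) := by
  cases t <;> simp [nextStatus]
  split_ifs <;> simp

lemma rejectState_status (s : AlgState A B) (b : B) (p q : A × Fin 2) (a : A) :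
    (I.rejectState s b p q).status a = if a = q.1 then
      I.nextStatus (recordRejection s b q.1) q.1 (s.status q.1) else s.status a := by
  simp [rejectState, Function.update_apply]

lemma rejectState_rejectedAs (s : AlgState A B) (b : B) (p q : A × Fin 2) (a : A) (b' : B)
    (t : Status) : (I.rejectState s b p q).rejectedAs a b' t ↔
      s.rejectedAs a b' t ∨ (a = q.1 ∧ b' = b ∧ t = s.status q.1) := by
  rfl

lemma rejectState_held (s : AlgState A B) (b : B) (p q : A × Fin 2) (b' : B) :
    (I.rejectState s b p q).held b' =
      if b' = b then (insert p (s.held b)).erase q else s.held b' := by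
  simp [rejectState, Function.update_apply]

lemma rejectState_pos (s : AlgState A B) (b : B) (p q r : A × Fin 2) :
    (I.rejectState s b p q).pos r =
      if r = q then (s.pos q + 1) % (I.menList q.1).length else s.pos r := by
  simp [rejectState, Function.update_apply]

lemma rank_le_rank_rejectState (s : AlgState A B) (b : B) (p q : A × Fin 2) (b' : B) (a : A) :
    s.rank b' a ≤ (I.rejectState s b p q).rank b' a := by
  have hrej : s.Rejected b' a → (I.rejectState s b p q).Rejected b' a := fun ⟨t, ht⟩ => ⟨t, .inl ht⟩
  have h3 : s.status a = Status.twoPromoted →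
      (I.rejectState s b p q).status a = Status.twoPromoted := by
    rw [rejectState_status]
    split_ifs with h
    · rw [nextStatus_eq_twoPromoted, h]; exact .inl
    · exact id
  have h2 : s.status a = Status.onePromoted →
      (I.rejectState s b p q).status a ≠ Status.basic := by
    rw [rejectState_status]
    split_ifs with h
    · rw [Ne, nextStatus_eq_basic, h]; intro h; simp [h]
    · intro h; simp [h]
  unfold AlgState.rank
  cases h : s.status a <;> cases h' : (I.rejectState s b p q).status a <;> simp_all <;>
    split_ifs <;> simp_all

lemma AtLeast.reject {s : AlgState A B} {b' b : B} {a : A} {n : ℕ} (h : I.AtLeast s b' a n)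
    {p q : A × Fin 2} (hq : I.LeastDesirable s b (insert p (s.held b)) q) :
    I.AtLeast (I.rejectState s b p q) b' a n := by
  intro r hr hge
  have key : I.womanGE b' r.1 a ∧ n ≤ s.rank b' r.1 := by
    rw [rejectState_held] at hr
    split_ifs at hr with hb
    · subst hb
      rw [Finset.mem_erase, Finset.mem_insert] at hr
      obtain ⟨hrq, rfl | hr⟩ := hr
      · -- here `q` was held before, and the newcomer is at least as desirable as `q`
        have hqh : q ∈ s.held b' := by
          have := hq.1
          rw [Finset.mem_insert] at this
          exact this.resolve_left (Ne.symm hrq)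
        have h1 := (I.not_superior_iff s b' _ _).1 (hq.2 r (Finset.mem_insert_self _ _))
        rcases I.womanGE_total b' q.1 r.1 with h2 | h2
        · obtain ⟨h3, h4⟩ := h1 h2
          obtain ⟨h5, h6⟩ := h q hqh (I.womanGE_trans _ _ _ _ hge h3)
          exact ⟨I.womanGE_trans _ _ _ _ h3 h5, h6.trans h4⟩
        · obtain ⟨h5, h6⟩ := h q hqh (I.womanGE_trans _ _ _ _ hge h2)
          obtain ⟨h3, h4⟩ := h1 (I.womanGE_trans _ _ _ _ h5 hge)
          exact ⟨I.womanGE_trans _ _ _ _ h3 h5, h6.trans h4⟩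
      · exact h r hr hge
    · exact h r hr hge
  exact ⟨key.1, key.2.trans (I.rank_le_rank_rejectState ..)⟩

lemma atLeast_of_rejected {s : AlgState A B} {b : B} {p q : A × Fin 2}
    (hq : I.LeastDesirable s b (insert p (s.held b)) q) :
    I.AtLeast (I.rejectState s b p q) b q.1 (s.rank b q.1) := by
  intro r hr hge
  rw [rejectState_held, if_pos rfl] at hr
  have := (I.not_superior_iff s b _ _).1 (hq.2 r (Finset.mem_of_mem_erase hr)) hge
  exact ⟨this.1, this.2.trans (I.rank_le_rank_rejectState ..)⟩

lemma AtLeast.mono {s : AlgState A B} {b : B} {a : A} {m n : ℕ} (h : I.AtLeast s b a n)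
    (hmn : m ≤ n) : I.AtLeast s b a m :=
  fun r hr hge => ⟨(h r hr hge).1, hmn.trans (h r hr hge).2⟩

/-- The least rank that a man with the given status can have. -/
def rankOf : Status → ℕ
  | Status.basic => 0
  | Status.onePromoted => 2
  | Status.twoPromoted => 3

lemma rankOf_le (s : AlgState A B) (b : B) (a : A) : rankOf (s.status a) ≤ s.rank b a := by
  unfold AlgState.rank rankOf
  cases s.status a <;> simp

/-! ### Invariants of the proposal phase -/

/-- The invariants of the proposal phase. -/
structure Inv (s : AlgState A B) : Prop where
  card_le : ∀ b, (s.held b).card ≤ 2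
  target_held : ∀ b, ∀ p ∈ s.held b, I.target s p = some b
  full : ∀ a b t, s.rejectedAs a b t → (s.held b).card = 2
  rejectedAs_one : ∀ a b, s.rejectedAs a b Status.onePromoted → s.status a ≠ Status.basic
  rejectedAs_two : ∀ a b, s.rejectedAs a b Status.twoPromoted →
    s.status a = Status.twoPromoted
  promoted_one : ∀ a, s.status a = Status.onePromoted →
    ∀ b, I.Edge a b → s.rejectedAs a b Status.basic
  promoted_two : ∀ a, s.status a = Status.twoPromoted →
    ∀ b, I.Edge a b → s.rejectedAs a b Status.onePromoted
  pos_lt : ∀ p : A × Fin 2, I.menList p.1 ≠ [] → s.pos p < (I.menList p.1).length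
  /-- A basic man has been rejected exactly by the women that one of his proposals has passed. -/
  basic_rejected : ∀ a, s.status a = Status.basic → ∀ b, I.Edge a b →
    (s.rejectedAs a b Status.basic ↔ ∃ i, (I.menList a).idxOf b < s.pos (a, i))
  atLeast : ∀ a b t, s.rejectedAs a b t → I.AtLeast s b a (rankOf t)
  /-- The second rejection of a basic man happens at rank `1`. -/
  both_rejected : ∀ a, s.status a = Status.basic → ∀ b, I.Edge a b →
    (∀ i, (I.menList a).idxOf b < s.pos (a, i)) → I.AtLeast s b a 1
  /-- A 1-promoted man started with one proposal at the top of his list, while the women before the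
  position of the other one had each rejected both proposals of his as a basic man. A woman passed
  later has rejected him as a 1-promoted man. -/
  one_passed : ∀ a, s.status a = Status.onePromoted → ∀ b, I.Edge a b →
    (∃ i, (I.menList a).idxOf b < s.pos (a, i)) → I.AtLeast s b a 1

lemma inv_init : I.Inv (initState A B) := by
  constructor <;> simp [initState, AtLeast, List.length_pos_iff]

variable {I}

lemma Inv.accept {s : AlgState A B} (h : I.Inv s) {p : A × Fin 2} {b : B}
    (ht : I.target s p = some b) (hp : p ∉ s.held b) (hc : (s.held b).card ≤ 1) :
    I.Inv (acceptState s b p) := by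
  have hrank : ∀ b' a, (acceptState s b p).rank b' a = s.rank b' a := fun _ _ => rfl
  -- a woman who has rejected somebody holds two proposals, so she is not the accepting one
  have hheld : ∀ a b' t, s.rejectedAs a b' t → (acceptState s b p).held b' = s.held b' := by
    intro a b' t hr
    have hb : b' ≠ b := by
      rintro rfl
      have := h.full a b' t hr
      omega
    simp [acceptState, hb]
  have hat : ∀ a b' t n, s.rejectedAs a b' t → I.AtLeast s b' a n →
      I.AtLeast (acceptState s b p) b' a n := by
    intro a b' t n hr hl r hrh
    rw [hheld a b' t hr] at hrh
    exact hl r hrh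
  constructor
  · intro b'
    by_cases hb : b' = b
    · subst hb
      simp [acceptState, hp]; omega
    · simpa [acceptState, hb] using h.card_le b'
  · intro b' q hq
    by_cases hb : b' = b
    · subst hb
      simp only [acceptState, Function.update_self, Finset.mem_insert] at hq
      rcases hq with rfl | hq
      · exact ht
      · exact h.target_held b' q hq
    · simp only [acceptState, Function.update_of_ne hb] at hq
      exact h.target_held b' q hq
  · intro a b' t hr
    rw [hheld a b' t hr]; exact h.full a b' t hr
  · exact h.rejectedAs_one
  · exact h.rejectedAs_two
  · exact h.promoted_one
  · exact h.promoted_two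
  · exact h.pos_lt
  · exact h.basic_rejected
  · exact fun a b' t hr => hat a b' t _ hr (h.atLeast a b' t hr)
  · intro a ha b' he hpos
    exact hat a b' Status.basic _ ((h.basic_rejected a ha b' he).2 ⟨0, hpos 0⟩)
      (h.both_rejected a ha b' he hpos)
  · intro a ha b' he hpos
    exact hat a b' Status.basic _ (h.promoted_one a ha b' he) (h.one_passed a ha b' he hpos)

/-- The woman to whom a proposal is offered has the position of the proposal on the list. -/
lemma target_eq_some_iff {s : AlgState A B} {p : A × Fin 2} {b : B} :
    I.target s p = some b ↔ I.Edge p.1 b ∧ s.pos p = (I.menList p.1).idxOf b := by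
  unfold target Edge
  constructor
  · intro h
    obtain ⟨hlt, rfl⟩ := List.getElem?_eq_some_iff.1 h
    exact ⟨List.getElem_mem hlt, ((I.menList_nodup p.1).idxOf_getElem _ hlt).symm⟩
  · rintro ⟨hm, h⟩
    rw [h]
    exact List.getElem?_idxOf hm

lemma idxOf_inj {a : A} {b b' : B} (hb : I.Edge a b)
    (h : (I.menList a).idxOf b = (I.menList a).idxOf b') : b = b' :=
  (List.idxOf_inj hb).1 h

lemma Inv.reject {s : AlgState A B} (h : I.Inv s) {p q : A × Fin 2} {b : B}
    (ht : I.target s p = some b) (hp : p ∉ s.held b) (hc : 2 ≤ (s.held b).card)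
    (hq : I.LeastDesirable s b (insert p (s.held b)) q) :
    I.Inv (I.rejectState s b p q) := by
  have hcard : (s.held b).card = 2 := le_antisymm (h.card_le b) hc
  have hcard' : ((insert p (s.held b)).erase q).card = 2 := by
    rw [Finset.card_erase_of_mem hq.1, Finset.card_insert_of_notMem hp, hcard]
  have htq : I.target s q = some b := by
    rcases Finset.mem_insert.1 hq.1 with rfl | hq
    · exact ht
    · exact h.target_held b q hq
  obtain ⟨heq, hposq⟩ := target_eq_some_iff.1 htq
  have hlen : (I.menList q.1).idxOf b < (I.menList q.1).length := List.idxOf_lt_length_iff.2 heq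
  have hkeep : ∀ b' a n, I.AtLeast s b' a n → I.AtLeast (I.rejectState s b p q) b' a n :=
    fun _ _ _ hl => hl.reject I hq
  have hnew := I.atLeast_of_rejected hq
  -- a position beyond `b'` of a proposal after the step comes from a position not before `b'`
  have hpos_lt : ∀ a b' i, I.Edge a b' →
      (I.menList a).idxOf b' < (I.rejectState s b p q).pos (a, i) →
      (I.menList a).idxOf b' < s.pos (a, i) ∨ ((a, i) = q ∧ b' = b) := by
    intro a b' i he hlt
    rw [rejectState_pos] at hlt
    split_ifs at hlt with hqe
    · subst hqe
      have h1 := Nat.mod_le (s.pos (a, i) + 1) (I.menList a).length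
      rcases (show (I.menList a).idxOf b' < s.pos (a, i) ∨
        (I.menList a).idxOf b' = s.pos (a, i) by simp only at hlt; omega) with h2 | h2
      · exact .inl h2
      · exact .inr ⟨rfl, idxOf_inj he (h2.trans hposq)⟩
    · exact .inl hlt
  -- a man who stays basic does not wrap around
  have hsucc : (I.rejectState s b p q).status q.1 = Status.basic →
      (I.rejectState s b p q).pos q = s.pos q + 1 := by
    intro hb
    rw [rejectState_status, if_pos rfl, nextStatus_eq_basic] at hb
    obtain ⟨hbs, hnot⟩ := hb
    rw [rejectState_pos, if_pos rfl]
    apply Nat.mod_eq_of_lt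
    by_contra hge
    apply hnot
    intro b' he'
    have h1 : (I.menList q.1).idxOf b' < (I.menList q.1).length := List.idxOf_lt_length_iff.2 he'
    rcases (show (I.menList q.1).idxOf b' < s.pos q ∨
      (I.menList q.1).idxOf b' = s.pos q by omega) with h2 | h2
    · exact .inl ((h.basic_rejected _ hbs b' he').2 ⟨q.2, h2⟩)
    · exact .inr ⟨rfl, idxOf_inj he' (h2.trans hposq), hbs.symm⟩
  constructor
  · intro b'
    rw [rejectState_held]
    split_ifs
    · exact hcard'.le
    · exact h.card_le b'
  · intro b' r hr
    rw [rejectState_held] at hr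
    have hrt : I.target s r = some b' ∧ r ≠ q := by
      split_ifs at hr with hb
      · subst hb
        rw [Finset.mem_erase, Finset.mem_insert] at hr
        obtain ⟨hrq, rfl | hr⟩ := hr
        · exact ⟨ht, hrq⟩
        · exact ⟨h.target_held _ _ hr, hrq⟩
      · refine ⟨h.target_held _ _ hr, ?_⟩
        rintro rfl
        have := (h.target_held _ _ hr).symm.trans htq
        simp_all
    rw [target_eq_some_iff] at *
    rw [rejectState_pos, if_neg hrt.2]
    exact hrt.1
  · intro a b' t hr
    rw [rejectState_held]
    split_ifs with hb
    · exact hcard'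
    · rw [rejectState_rejectedAs] at hr
      exact h.full a b' t (hr.resolve_right (fun hh => hb hh.2.1))
  · intro a b' hr
    rw [rejectState_rejectedAs] at hr
    have := h.rejectedAs_one a b'
    rw [rejectState_status]
    split_ifs with ha
    · rw [Ne, nextStatus_eq_basic]
      grind
    · grind
  · intro a b' hr
    rw [rejectState_rejectedAs] at hr
    have := h.rejectedAs_two a b'
    rw [rejectState_status]
    split_ifs with ha
    · rw [nextStatus_eq_twoPromoted]
      grind
    · grind
  · intro a ha b' he
    rw [rejectState_status] at ha
    rw [rejectState_rejectedAs]
    split_ifs at ha with haq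
    · subst haq
      rw [nextStatus_eq_onePromoted] at ha
      rcases ha with ⟨-, ha⟩ | ⟨ha, -⟩
      · exact ha b' he
      · exact .inl (h.promoted_one _ ha b' he)
    · exact .inl (h.promoted_one _ ha b' he)
  · intro a ha b' he
    rw [rejectState_status] at ha
    rw [rejectState_rejectedAs]
    split_ifs at ha with haq
    · subst haq
      rw [nextStatus_eq_twoPromoted] at ha
      rcases ha with ha | ⟨-, ha⟩
      · exact .inl (h.promoted_two _ ha b' he)
      · exact ha b' he
    · exact .inl (h.promoted_two _ ha b' he)
  · intro r hr
    rw [rejectState_pos]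
    split_ifs with hrq
    · subst hrq
      exact Nat.mod_lt _ (List.length_pos_iff.2 hr)
    · exact h.pos_lt r hr
  · intro a ha b' he
    by_cases haq : a = q.1
    · subst haq
      have hs := hsucc ha
      have hbs : s.status q.1 = Status.basic := by
        rw [rejectState_status, if_pos rfl, nextStatus_eq_basic] at ha
        exact ha.1
      constructor
      · intro hr
        rw [rejectState_rejectedAs] at hr
        rcases hr with hr | ⟨-, rfl, -⟩
        · obtain ⟨i, hi⟩ := (h.basic_rejected _ hbs b' he).1 hr
          refine ⟨i, ?_⟩
          by_cases hiq : (q.1, i) = q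
          · rw [hiq] at hi ⊢
            omega
          · rwa [rejectState_pos, if_neg hiq]
        · exact ⟨q.2, by simp only [Prod.mk.eta]; omega⟩
      · rintro ⟨i, hi⟩
        rw [rejectState_rejectedAs]
        rcases hpos_lt _ _ _ he hi with h1 | ⟨-, h1⟩
        · exact .inl ((h.basic_rejected _ hbs b' he).2 ⟨i, h1⟩)
        · exact .inr ⟨rfl, h1, hbs.symm⟩
    · have hne : ∀ i, (a, i) ≠ q := fun i hi => haq (by rw [← hi])
      rw [rejectState_status, if_neg haq] at ha
      simp only [rejectState_rejectedAs, rejectState_pos, hne, haq, if_false, false_and, or_false]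
      exact h.basic_rejected a ha b' he
  · intro a b' t hr
    rw [rejectState_rejectedAs] at hr
    rcases hr with hr | ⟨rfl, rfl, rfl⟩
    · exact hkeep _ _ _ (h.atLeast a b' t hr)
    · exact hnew.mono I (rankOf_le ..)
  · intro a ha b' he hpos
    by_cases haq : a = q.1
    · subst haq
      have hbs : s.status q.1 = Status.basic := by
        rw [rejectState_status, if_pos rfl, nextStatus_eq_basic] at ha
        exact ha.1
      by_cases hb : b' = b
      · subst hb
        -- the other proposal had passed `b'` before, hence `q` was rejected at rank `1`
        obtain ⟨i, hi⟩ : ∃ i, (q.1, i) ≠ q := ⟨q.2 + 1, fun hh => by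
          have h2 : q.2 + 1 = q.2 := congrArg Prod.snd hh
          revert h2
          generalize q.2 = j
          revert j
          decide⟩
        have h1 := (hpos_lt _ _ _ he (hpos i)).resolve_right (fun hh => hi hh.1)
        refine hnew.mono I (AlgState.one_le_rank_of_rejected ⟨Status.basic, ?_⟩)
        exact (h.basic_rejected _ hbs b' he).2 ⟨i, h1⟩
      · exact hkeep _ _ _ (h.both_rejected _ hbs b' he fun i =>
          (hpos_lt _ _ _ he (hpos i)).resolve_right (fun hh => hb hh.2))
    · rw [rejectState_status, if_neg haq] at ha
      exact hkeep _ _ _ (h.both_rejected a ha b' he fun i =>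
          (hpos_lt _ _ _ he (hpos i)).resolve_right (fun hh => haq (by rw [← hh.1])))
  · rintro a ha b' he ⟨i, hi⟩
    by_cases haq : a = q.1
    · subst haq
      rw [rejectState_status, if_pos rfl, nextStatus_eq_onePromoted] at ha
      rcases ha with ⟨hbs, hall⟩ | ⟨hone, -⟩
      · -- the last woman on the list can only have rejected `q` in this step
        have hwrap : s.pos q + 1 = (I.menList q.1).length := by
          by_contra hne
          have hl : (I.menList q.1).length - 1 < (I.menList q.1).length := by omega
          have hm : I.Edge q.1 (I.menList q.1)[(I.menList q.1).length - 1] := List.getElem_mem hl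
          have hidx := (I.menList_nodup q.1).idxOf_getElem _ hl
          rcases hall _ hm with h1 | ⟨-, h1, -⟩
          · obtain ⟨j, hj⟩ := (h.basic_rejected _ hbs _ hm).1 h1
            have := h.pos_lt (q.1, j) (List.ne_nil_of_mem heq)
            simp only at this
            omega
          · rw [h1] at hidx
            omega
        have hz : (I.rejectState s b p q).pos q = 0 := by
          rw [rejectState_pos, if_pos rfl, hwrap, Nat.mod_self]
        have hiq : (q.1, i) ≠ q := by
          intro hh
          rw [hh, hz] at hi
          omega
        rw [rejectState_pos, if_neg hiq] at hi
        have hlt := h.pos_lt (q.1, i) (List.ne_nil_of_mem heq)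
        refine hkeep _ _ _ (h.both_rejected _ hbs b' he fun j => ?_)
        by_cases hjq : (q.1, j) = q
        · rw [hjq]
          simp only at hlt
          omega
        · have : j = i := by
            have h1 : j ≠ q.2 := fun hh => hjq (by rw [hh])
            have h2 : i ≠ q.2 := fun hh => hiq (by rw [hh])
            omega
          rwa [this]
      · rcases hpos_lt _ _ _ he hi with h1 | ⟨-, rfl⟩
        · exact hkeep _ _ _ (h.one_passed _ hone b' he ⟨i, h1⟩)
        · refine hnew.mono I (le_trans (by norm_num) (AlgState.two_le_rank.2 ?_))
          simp [hone]
    · rw [rejectState_status, if_neg haq] at ha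
      exact hkeep _ _ _ (h.one_passed a ha b' he
        ⟨i, (hpos_lt _ _ _ he hi).resolve_right (fun hh => haq (by rw [← hh.1]))⟩)

lemma inv_of_reachable {s : AlgState A B} (h : Relation.ReflTransGen I.Step (initState A B) s) :
    I.Inv s := by
  induction h with
  | refl => exact I.inv_init
  | tail _ hstep ih =>
    cases hstep with
    | accept p b _ ht hp hc => exact ih.accept ht hp hc
    | reject p q b _ ht hp hc hq => exact ih.reject ht hp hc hq

variable {s : AlgState A B}

/-! ### The final state -/

lemma IsFinal.inv (hs : I.IsFinal s) : I.Inv s := inv_of_reachable hs.1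

lemma IsFinal.mem_held (hs : I.IsFinal s) {p : A × Fin 2} {b : B} (hp : ¬ I.Stopped s p.1)
    (ht : I.target s p = some b) : p ∈ s.held b := by
  by_contra hnot
  rcases Nat.lt_or_ge 1 (s.held b).card with hc | hc
  · obtain ⟨q, hq⟩ := I.exists_leastDesirable s b (insert p (s.held b)) (Finset.insert_nonempty _ _)
    exact hs.2 _ (Step.reject s p q b hp ht hnot hc hq)
  · exact hs.2 _ (Step.accept s p b hp ht hnot hc)

lemma IsFinal.exists_held (hs : I.IsFinal s) {a : A} {b : B} (ha : ¬ I.Stopped s a)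
    (he : I.Edge a b) (i : Fin 2) :
    ∃ c, (a, i) ∈ s.held c ∧ I.Edge a c ∧ s.pos (a, i) = (I.menList a).idxOf c := by
  have hlt := hs.inv.pos_lt (a, i) (List.ne_nil_of_mem he)
  have ht : I.target s (a, i) = some (I.menList a)[s.pos (a, i)] := List.getElem?_eq_getElem hlt
  exact ⟨_, hs.mem_held ha ht, target_eq_some_iff.1 ht⟩

lemma Inv.edge_of_held (h : I.Inv s) {p : A × Fin 2} {b : B} (hp : p ∈ s.held b) :
    I.Edge p.1 b ∧ s.pos p = (I.menList p.1).idxOf b :=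
  target_eq_some_iff.1 (h.target_held b p hp)

lemma Inv.edge_of_gEdge (h : I.Inv s) {a : A} {b : B} (hg : s.GEdge a b) : I.Edge a b := by
  obtain ⟨i, hi⟩ := hg
  exact (h.edge_of_held hi).1

lemma Inv.held_unique (h : I.Inv s) {p : A × Fin 2} {b c : B} (hb : p ∈ s.held b)
    (hc : p ∈ s.held c) : b = c :=
  Option.some_injective _ ((h.target_held b p hb).symm.trans (h.target_held c p hc))

/-- A man that some woman has never rejected is basic, and neither of his proposals has passed
her. -/
lemma Inv.basic_of_not_rejected (h : I.Inv s) {a : A} {b : B} (he : I.Edge a b)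
    (hr : ¬ s.Rejected b a) :
    s.status a = Status.basic ∧ ∀ i, s.pos (a, i) ≤ (I.menList a).idxOf b := by
  have hb : s.status a = Status.basic := by
    cases hst : s.status a
    · rfl
    · exact (hr ⟨_, h.promoted_one a hst b he⟩).elim
    · exact (hr ⟨_, h.promoted_two a hst b he⟩).elim
  refine ⟨hb, fun i => ?_⟩
  by_contra hlt
  exact hr ⟨_, (h.basic_rejected a hb b he).2 ⟨i, not_le.1 hlt⟩⟩

lemma Inv.not_rejected_of_pos_le (h : I.Inv s) {a : A} {b : B} (he : I.Edge a b)
    (hb : s.status a = Status.basic) (hpos : ∀ i, s.pos (a, i) ≤ (I.menList a).idxOf b) :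
    ¬ s.Rejected b a := by
  rintro ⟨t, ht⟩
  cases t
  · obtain ⟨i, hi⟩ := (h.basic_rejected a hb b he).1 ht
    exact (hpos i).not_gt hi
  · exact h.rejectedAs_one a b ht hb
  · have := h.rejectedAs_two a b ht
    simp [hb] at this

/-! ### The graph `G'` and the matching `M` -/

lemma adj_inl_inr (s : AlgState A B) (a : A) (b : B) :
    s.graph.Adj (Sum.inl a) (Sum.inr b) ↔ s.GEdge a b := by
  simp [AlgState.graph]

lemma not_adj_inr_inr (s : AlgState A B) (b b' : B) :
    ¬ s.graph.Adj (Sum.inr b) (Sum.inr b') := by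
  simp [AlgState.graph]

lemma not_adj_inl_inl (s : AlgState A B) (a a' : A) :
    ¬ s.graph.Adj (Sum.inl a) (Sum.inl a') := by
  simp [AlgState.graph]

/-- Men have degree at most two in `G'`. -/
lemma Inv.eq_or_eq_of_gEdge (h : I.Inv s) {a : A} {b c d : B} (hb : s.GEdge a b)
    (hc : s.GEdge a c) (hbc : b ≠ c) (hd : s.GEdge a d) : d = b ∨ d = c := by
  obtain ⟨i, hi⟩ := hb
  obtain ⟨j, hj⟩ := hc
  obtain ⟨l, hl⟩ := hd
  have hij : i ≠ j := fun hij => hbc (h.held_unique hi (hij ▸ hj))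
  rcases (show l = i ∨ l = j by omega) with rfl | rfl
  · exact .inl (h.held_unique hl hi)
  · exact .inr (h.held_unique hl hj)

lemma Inv.held_eq_pair (h : I.Inv s) {p q : A × Fin 2} {b : B} (hpq : p ≠ q) (hp : p ∈ s.held b)
    (hq : q ∈ s.held b) : s.held b = {p, q} := by
  symm
  apply Finset.eq_of_subset_of_card_le
  · intro r hr
    simp only [Finset.mem_insert, Finset.mem_singleton] at hr
    rcases hr with rfl | rfl <;> assumption
  · rw [Finset.card_pair hpq]
    exact h.card_le b

/-- A man both of whose proposals are held by the same woman forms a component of `G'` together with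
her, so the maximum cardinality of `M` forces `M` to contain this edge. -/
lemma Inv.mem_of_both_held (h : I.Inv s) {M : Finset (A × B)} (hM : IsOutput s M) {a : A} {b : B}
    (hb : ∀ i, (a, i) ∈ s.held b) : (a, b) ∈ M := by
  by_contra hnot
  obtain ⟨⟨⟨hM1, hM2⟩, hMG⟩, hmax, -, -⟩ := hM
  have hpair := h.held_eq_pair (p := (a, 0)) (q := (a, 1)) (by simp) (hb 0) (hb 1)
  have ha : ∀ c, (a, c) ∉ M := by
    intro c hc
    obtain ⟨i, hi⟩ := hMG a c hc
    exact hnot (h.held_unique hi (hb i) ▸ hc)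
  have hw : ∀ a', (a', b) ∉ M := by
    intro a' hc
    obtain ⟨i, hi⟩ := hMG a' b hc
    rw [hpair] at hi
    have : a' = a := by simp at hi; tauto
    exact hnot (this ▸ hc)
  have hle := hmax (insert (a, b) M) ⟨?_, ?_⟩ ?_
  · rw [Finset.card_insert_of_notMem hnot] at hle
    omega
  · intro x y y' hy hy'
    simp only [Finset.mem_insert, Prod.mk.injEq] at hy hy'
    rcases hy with ⟨rfl, rfl⟩ | hy <;> rcases hy' with ⟨h1, rfl⟩ | hy'
    · rfl
    · exact (ha _ hy').elim
    · exact (ha _ (h1 ▸ hy)).elim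
    · exact hM1 _ _ _ hy hy'
  · intro x x' y hy hy'
    simp only [Finset.mem_insert, Prod.mk.injEq] at hy hy'
    rcases hy with ⟨rfl, rfl⟩ | hy <;> rcases hy' with ⟨rfl, h1⟩ | hy'
    · rfl
    · exact (hw _ hy').elim
    · exact (hw _ (h1 ▸ hy)).elim
    · exact hM2 _ _ _ hy hy'
  · intro x y hxy
    simp only [Finset.mem_insert, Prod.mk.injEq] at hxy
    rcases hxy with ⟨rfl, rfl⟩ | hxy
    · exact ⟨0, hb 0⟩
    · exact hMG _ _ hxy

/-- A man unmatched by `M` has used up all his proposals. -/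
lemma IsFinal.stopped_of_not_manMatched (hs : I.IsFinal s) {M : Finset (A × B)}
    (hM : IsOutput s M) {a : A} {b : B} (he : I.Edge a b) (ha : ¬ ManMatched M a) :
    I.Stopped s a := by
  by_contra hquit
  obtain ⟨c, hc, -⟩ := hs.exists_held hquit he 0
  obtain ⟨d, hd, -⟩ := hs.exists_held hquit he 1
  by_cases hcd : c = d
  · subst hcd
    refine ha ⟨c, hs.inv.mem_of_both_held hM fun i => ?_⟩
    fin_cases i
    exacts [hc, hd]
  · refine ha (hM.2.2.1 a ?_)
    have : s.graph.neighborSet (Sum.inl a) = {Sum.inr c, Sum.inr d} := by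
      ext v
      rw [SimpleGraph.mem_neighborSet]
      cases v with
      | inl a' => simp [not_adj_inl_inl]
      | inr b' =>
        rw [adj_inl_inr]
        simp only [Set.mem_insert_iff, Set.mem_singleton_iff, Sum.inr.injEq]
        constructor
        · exact hs.inv.eq_or_eq_of_gEdge ⟨0, hc⟩ ⟨1, hd⟩ hcd
        · rintro (rfl | rfl)
          exacts [⟨0, hc⟩, ⟨1, hd⟩]
    rw [this]
    exact Set.ncard_pair (by simpa using hcd)

lemma Inv.card_held_le_one_of_not_womanMatched (h : I.Inv s) {M : Finset (A × B)}
    (hM : IsOutput s M) {b : B} (hb : ¬ WomanMatched M b) : (s.held b).card ≤ 1 := by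
  by_contra hlt
  obtain ⟨p, hp, q, hq, hpq⟩ := Finset.one_lt_card.1 (not_le.1 hlt)
  have hpair := h.held_eq_pair hpq hp hq
  by_cases hcd : p.1 = q.1
  · refine hb ⟨p.1, h.mem_of_both_held hM fun i => ?_⟩
    have h2 : p.2 ≠ q.2 := fun h2 => hpq (Prod.ext hcd h2)
    rcases (show i = p.2 ∨ i = q.2 by omega) with rfl | rfl
    · exact hp
    · rw [hcd]; exact hq
  · refine hb (hM.2.2.2 b ?_)
    have : s.graph.neighborSet (Sum.inr b) = {Sum.inl p.1, Sum.inl q.1} := by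
      ext v
      rw [SimpleGraph.mem_neighborSet, SimpleGraph.adj_comm]
      cases v with
      | inr b' => simp [not_adj_inr_inr]
      | inl a' =>
        rw [adj_inl_inr]
        simp only [Set.mem_insert_iff, Set.mem_singleton_iff, Sum.inl.injEq]
        constructor
        · rintro ⟨i, hi⟩
          rw [hpair, Finset.mem_insert, Finset.mem_singleton] at hi
          rcases hi with hi | hi
          · exact .inl (congrArg Prod.fst hi)
          · exact .inr (congrArg Prod.fst hi)
        · rintro (rfl | rfl)
          exacts [⟨_, hp⟩, ⟨_, hq⟩]
    rw [this]
    exact Set.ncard_pair (by simpa using hcd)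

lemma Inv.not_rejected_of_card_le_one (h : I.Inv s) {b : B} (hb : (s.held b).card ≤ 1) (a : A) :
    ¬ s.Rejected b a := by
  rintro ⟨t, ht⟩
  have := h.full a b t ht
  omega

/-- A matched woman at the far end of a maximal path of `G'` that starts at an unmatched woman holds
only one proposal: otherwise she would hold both proposals of her only neighbour, who has a further
neighbour on the path. -/
lemma Inv.card_held_le_one_of_mJump (h : I.Inv s) {M : Finset (A × B)} {b c : B}
    (hj : MJump s M b c) (hc : WomanMatched M c) : (s.held c).card ≤ 1 := by
  obtain ⟨hb, -, p, hp, -, hend⟩ := hj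
  have hbc : b ≠ c := by
    rintro rfl
    exact hb hc
  have hlen : p.length ≠ 0 := by
    intro h0
    have := p.eq_of_length_eq_zero h0
    simp at this
    exact hbc this
  have hinj := hp.getVert_injOn
  -- the only neighbour of `c` is the last vertex before it
  have hlast : ∀ a, s.GEdge a c → p.getVert (p.length - 1) = Sum.inl a ∧
      ∃ d, d ≠ c ∧ s.GEdge a d := by
    intro a ha
    have hadj : s.graph.Adj (Sum.inr c) (Sum.inl a) := ((adj_inl_inr s a c).2 ha).symm
    obtain ⟨j, hjv, hjl⟩ := SimpleGraph.Walk.mem_support_iff_exists_getVert.1 (hend _ hadj)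
    have hj0 : j ≠ 0 := by
      rintro rfl
      simp at hjv
    have hjlen : j ≠ p.length := by
      rintro rfl
      simp at hjv
    have hprev : s.graph.Adj (p.getVert (j - 1)) (p.getVert j) := by
      have := p.adj_getVert_succ (i := j - 1) (by omega)
      rwa [Nat.sub_add_cancel (by omega)] at this
    have hnext := p.adj_getVert_succ (i := j) (by omega)
    rw [hjv] at hprev hnext
    obtain ⟨d, hd⟩ : ∃ d, p.getVert (j - 1) = Sum.inr d := by
      cases hv : p.getVert (j - 1) with
      | inl a' => rw [hv] at hprev; exact (not_adj_inl_inl s _ _ hprev).elim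
      | inr d => exact ⟨d, rfl⟩
    obtain ⟨e, he⟩ : ∃ e, p.getVert (j + 1) = Sum.inr e := by
      cases hv : p.getVert (j + 1) with
      | inl a' => rw [hv] at hnext; exact (not_adj_inl_inl s _ _ hnext).elim
      | inr e => exact ⟨e, rfl⟩
    have hdc : d ≠ c := by
      rintro rfl
      have := hinj (show j - 1 ≤ p.length by omega) (show p.length ≤ p.length from le_rfl)
        (by rw [hd, p.getVert_length])
      omega
    rw [hd] at hprev
    have had := (adj_inl_inr s a d).1 hprev.symm
    refine ⟨?_, d, hdc, had⟩
    by_cases hjm : j = p.length - 1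
    · rw [← hjm, hjv]
    · exfalso
      have hec : e ≠ c := by
        rintro rfl
        have := hinj (show j + 1 ≤ p.length by omega) (show p.length ≤ p.length from le_rfl)
          (by rw [he, p.getVert_length])
        omega
      have hde : d ≠ e := by
        rintro rfl
        have := hinj (show j - 1 ≤ p.length by omega) (show j + 1 ≤ p.length by omega)
          (by rw [hd, he])
        omega
      rw [he] at hnext
      rcases h.eq_or_eq_of_gEdge had ((adj_inl_inr s a e).1 hnext) hde ha with h1 | h1
      · exact hdc h1.symm
      · exact hec h1.symm
  by_contra hlt
  obtain ⟨x, hx, y, hy, hxy⟩ := Finset.one_lt_card.1 (not_le.1 hlt)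
  obtain ⟨hx1, d, hdc, i, hi⟩ := hlast x.1 ⟨x.2, hx⟩
  obtain ⟨hy1, -⟩ := hlast y.1 ⟨y.2, hy⟩
  have hxy1 : x.1 = y.1 := by
    have := hx1.symm.trans hy1
    simpa using this
  have h2 : x.2 ≠ y.2 := fun h2 => hxy (Prod.ext hxy1 h2)
  rcases (show i = x.2 ∨ i = y.2 by omega) with rfl | rfl
  · exact hdc (h.held_unique hi hx)
  · rw [hxy1] at hi
    exact hdc (h.held_unique hi hy)

/-! ### Augmenting paths and critical arcs -/

lemma manPrefers_of_idxOf_le {a : A} {b b' : B} (hb : I.Edge a b) (hb' : I.Edge a b')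
    (hne : b ≠ b') (hle : (I.menList a).idxOf b ≤ (I.menList a).idxOf b') : I.ManPrefers a b b' :=
  ⟨hb, hb', lt_of_le_of_ne hle fun he => hne (idxOf_inj hb he)⟩

lemma ManGE.idxOf_le {a : A} {b b' : B} (h : I.ManGE a b b') :
    (I.menList a).idxOf b ≤ (I.menList a).idxOf b' := by
  rcases h with rfl | h
  · exact le_rfl
  · exact h.2.2.le

/-- In a stable matching, a woman likes her partner at least as much as any man who prefers her to
his own partner. -/
lemma IsStable.womanGE {N : Finset (A × B)} (hN : I.IsStable N) {a a' : A} {b b' : B}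
    (hab : (a, b) ∈ N) (hab' : (a', b') ∈ N) (hp : I.ManPrefers a b' b) : I.womanGE b' a' a := by
  by_contra hge
  refine hN.2.2 a b' ⟨hp.1, ?_, .inr ⟨b, hab, hp⟩, .inr ⟨a', hab', ?_, hge⟩⟩
  · intro hc
    have := hN.1.1 _ _ _ hab hc
    have h2 := hp.2.2
    simp [this] at h2
  · exact (I.womanGE_total b' a a').resolve_right hge

lemma _root_.OneSidedTies.Contracted.mem {M OPT : Finset (A × B)} {a : A} {b : B}
    (h : Contracted M OPT a b) : (a, b) ∈ M := by
  rcases h with ⟨k, α, β, hk, hp, rfl, rfl⟩ | ⟨k, α, β, hk, hp, rfl, rfl⟩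
  · exact (hp.m_edge 0 hk).1
  · have := (hp.m_edge (k - 1) (by omega)).1
    rwa [Nat.sub_add_cancel hk] at this

/-- If the `OPT`-partner `b` of `a` is matched by `M`, a man who is not 2-promoted starts a critical
arc with every neighbour in `G'` outside `M` that he likes at least as much as `b`. -/
lemma criticalNextTo_of_gEdge {M OPT : Finset (A × B)} (hOPT : IsMatching OPT) {a : A} {b c : B}
    (hab : (a, b) ∈ OPT) (hb : WomanMatched M b) (hst : s.status a ≠ Status.twoPromoted)
    (hac : s.GEdge a c) (hM : (a, c) ∉ M) (hge : I.ManGE a c b) :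
    CriticalNextTo I s M OPT a c b := by
  refine ⟨⟨⟨a, c, hac, fun hcon => hM (Contracted.mem hcon), rfl, rfl⟩, ?_, hst, hM, ?_⟩,
    hab⟩
  · intro b' hb'
    rwa [hOPT.1 _ _ _ hb' hab]
  · rintro ⟨a', b', ⟨k, α, β, -, hp, rfl, rfl⟩, hX⟩
    have hmem : Sum.inl a ∈ node M OPT (Sum.inl a) := by simp [node]
    rw [hX] at hmem
    have ha : a = α k := by simpa using hmem
    subst ha
    rw [hOPT.1 _ _ _ hab (hp.opt_edge k le_rfl).1] at hb
    exact hp.last_unmatched hb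

/-- The first matched man of an augmenting path prefers his `OPT`-partner to his `M`-partner unless
he is 2-promoted: his `M`-partner has rejected the unmatched end of the path as a 2-promoted man, so
she strictly prefers him, and he would otherwise form a blocking pair of `OPT` with her. -/
lemma IsFinal.manPrefers_of_isAugPath (hs : I.IsFinal s) {M OPT : Finset (A × B)}
    (hM : IsOutput s M) (hOPT : I.IsStable OPT) {k : ℕ} {α : ℕ → A} {β : ℕ → B}
    (hp : IsAugPath M OPT k α β) (hk : 1 ≤ k) (hst : s.status (α 1) ≠ Status.twoPromoted) :
    I.ManPrefers (α 1) (β 1) (β 0) := by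
  have h0 := (hp.opt_edge 0 (by omega)).1
  have h1 := (hp.opt_edge 1 hk).1
  have hm : (α 1, β 0) ∈ M := (hp.m_edge 0 (by omega)).1
  have he0 : I.Edge (α 0) (β 0) := hOPT.2.1 _ _ h0
  have he1 : I.Edge (α 1) (β 1) := hOPT.2.1 _ _ h1
  have hrej := (hs.stopped_of_not_manMatched hM he0 hp.first_unmatched).2 _ he0
  have hg := hM.1.2 _ _ hm
  have he : I.Edge (α 1) (β 0) := hs.inv.edge_of_gEdge hg
  obtain ⟨i, hi⟩ := hg
  have hngt : ¬ I.womanGE (β 0) (α 0) (α 1) := fun hge =>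
    hst (AlgState.three_le_rank.1 (hs.inv.atLeast _ _ _ hrej _ hi hge).2)
  have hne : β 1 ≠ β 0 := fun hh =>
    absurd (hp.injOn_woman (Set.mem_Iic.2 hk) (Set.mem_Iic.2 (Nat.zero_le k)) hh) one_ne_zero
  refine manPrefers_of_idxOf_le he1 he hne ?_
  by_contra hlt
  exact hngt (hOPT.womanGE h1 h0 ⟨he, he1, not_le.1 hlt⟩)

/-! ### Where charge can end up -/

section Charging

variable [Fintype A] [Fintype B]

lemma charge3_ne_zero {M OPT : Finset (A × B)} {c : B} (h : charge3 I s M OPT c ≠ 0) :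
    (∃ α β, IsAugPath M OPT 2 α β ∧ LessPreferredNeighbor I s (α 2) c) ∨
      ∃ b, MJump s M b c := by
  classical
  rw [charge3, Ne, Nat.add_eq_zero_iff, not_and_or] at h
  rcases h with h | h
  · left
    split_ifs at h with hc
    · obtain ⟨a, ha, hne⟩ := Finset.exists_ne_zero_of_sum_ne_zero h
      rw [Finset.mem_filter] at ha
      rw [charge1] at hne
      split_ifs at hne with hex
      · obtain ⟨α, β, hp, rfl⟩ := hex
        exact ⟨α, β, hp, ha.2⟩
      · exact (hne rfl).elim
    · exact (h rfl).elim
  · right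
    obtain ⟨b, hb, -⟩ := Finset.exists_ne_zero_of_sum_ne_zero h
    exact ⟨b, (Finset.mem_filter.1 hb).2.2⟩

/-- A matched woman keeping unpopularity charge has received charge, and no critical arc is next to
her. -/
lemma unpopularityCharge_ne_zero {M OPT : Finset (A × B)} {b : B}
    (h : unpopularityCharge I s M OPT b ≠ 0) :
    charge3 I s M OPT b ≠ 0 ∧ ∀ a c, ¬ CriticalNextTo I s M OPT a c b := by
  rw [unpopularityCharge, unpop4] at h
  split_ifs at h with h1 h2
  · exact (h rfl).elim
  · exact (h rfl).elim
  · exact ⟨h, fun a c hc => h2 ⟨a, c, hc⟩⟩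

end Charging

/-- The second woman of an augmenting path with at least five edges is not the end of a matching
jump, unless there is a critical arc next to her: a woman who ends such a jump has not rejected
anybody, so the proposals of her `OPT`-partner are at women he likes at least as much as her. -/
lemma IsFinal.not_mJump (hs : I.IsFinal s) {M OPT : Finset (A × B)} (hM : IsOutput s M)
    (hOPT : I.IsStable OPT) {k : ℕ} {α : ℕ → A} {β : ℕ → B} (hp : IsAugPath M OPT k α β)
    (hk : 2 ≤ k) (hcrit : ∀ c, ¬ CriticalNextTo I s M OPT (α 1) c (β 1)) (b : B) :
    ¬ MJump s M b (β 1) := by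
  intro hj
  have h1 := (hp.opt_edge 1 (by omega)).1
  have hmat : WomanMatched M (β 1) := ⟨α 2, (hp.m_edge 1 (by omega)).1⟩
  have he1 : I.Edge (α 1) (β 1) := hOPT.2.1 _ _ h1
  obtain ⟨hbas, hpos⟩ := hs.inv.basic_of_not_rejected he1
    (hs.inv.not_rejected_of_card_le_one (hs.inv.card_held_le_one_of_mJump hj hmat) _)
  have hst : s.status (α 1) ≠ Status.twoPromoted := by simp [hbas]
  have hpref := hs.manPrefers_of_isAugPath hM hOPT hp (by omega) hst
  obtain ⟨c, hc, hec, hposc⟩ := hs.exists_held (fun hquit => hst hquit.1) he1 0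
  have hle := hposc ▸ hpos 0
  refine hcrit c (criticalNextTo_of_gEdge hOPT.1 h1 hmat hst ⟨0, hc⟩ ?_ ?_)
  · intro hmem
    have := hM.1.1.1 _ _ _ hmem (hp.m_edge 0 (by omega)).1
    rw [this] at hle
    exact hle.not_gt hpref.2.2
  · by_cases hcb : c = β 1
    · exact .inl hcb
    · exact .inr (manPrefers_of_idxOf_le hec he1 hcb hle)

/-- The last man `a` of an augmenting path does not have the second woman `β 1` of an augmenting
path with at least five edges as less preferred neighbour in `G'`, unless there is a critical arc
next to her. She likes her `OPT`-partner `α 1` at least as much as `a`, who is basic and whom she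
has never rejected. Hence she has neither rejected `α 1` as a promoted man nor rejected two
proposals of his as a basic man, which leaves a proposal of `α 1` at a woman he likes at least as
much as her. -/
lemma IsFinal.not_lessPreferredNeighbor (hs : I.IsFinal s) {M OPT : Finset (A × B)}
    (hM : IsOutput s M) (hOPT : I.IsStable OPT) {k : ℕ} {α : ℕ → A} {β : ℕ → B}
    (hp : IsAugPath M OPT k α β) (hk : 2 ≤ k)
    (hcrit : ∀ c, ¬ CriticalNextTo I s M OPT (α 1) c (β 1)) {k' : ℕ} {α' : ℕ → A} {β' : ℕ → B}
    (hp' : IsAugPath M OPT k' α' β') : ¬ LessPreferredNeighbor I s (α' k') (β 1) := by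
  rintro ⟨hg, hless⟩
  have h := hs.inv
  have h1 := (hp.opt_edge 1 (by omega)).1
  have h' := (hp'.opt_edge k' le_rfl).1
  have hmat : WomanMatched M (β 1) := ⟨α 2, (hp.m_edge 1 (by omega)).1⟩
  have he1 : I.Edge (α 1) (β 1) := hOPT.2.1 _ _ h1
  have he' : I.Edge (α' k') (β' k') := hOPT.2.1 _ _ h'
  have hne : β 1 ≠ β' k' := fun hh => hp'.last_unmatched (hh ▸ hmat)
  -- `α' k'` is basic, and `β 1` lies between his proposals and his `OPT`-partner
  obtain ⟨hbas, hpos⟩ := h.basic_of_not_rejected he'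
    (h.not_rejected_of_card_le_one
      (h.card_held_le_one_of_not_womanMatched hM hp'.last_unmatched) _)
  have heg := h.edge_of_gEdge hg
  obtain ⟨i, hi⟩ := hg
  have hpref : I.ManPrefers (α' k') (β 1) (β' k') :=
    manPrefers_of_idxOf_le heg he' hne ((h.edge_of_held hi).2 ▸ hpos i)
  have hge : I.womanGE (β 1) (α 1) (α' k') := hOPT.womanGE h' h1 hpref
  have hnrej : ¬ s.Rejected (β 1) (α' k') := by
    refine h.not_rejected_of_pos_le heg hbas fun j => ?_
    obtain ⟨c, hc, -, hposc⟩ := hs.exists_held (fun hquit => by simp [hquit.1] at hbas) heg j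
    rw [hposc]
    exact ManGE.idxOf_le (hless c ⟨j, hc⟩)
  by_cases hst : s.status (α 1) = Status.twoPromoted
  · exact AlgState.two_le_rank.1
      (h.atLeast _ _ _ (h.promoted_two _ hst _ he1) _ hi hge).2 hbas
  · have hpref1 := hs.manPrefers_of_isAugPath hM hOPT hp (by omega) hst
    have hbeyond : ∀ j, (I.menList (α 1)).idxOf (β 1) < s.pos (α 1, j) := by
      intro j
      obtain ⟨c, hc, hec, hposc⟩ := hs.exists_held (fun hquit => hst hquit.1) he1 j
      by_contra hle
      rw [hposc, not_lt] at hle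
      refine hcrit c (criticalNextTo_of_gEdge hOPT.1 h1 hmat hst ⟨j, hc⟩ ?_ ?_)
      · intro hmem
        have := hM.1.1.1 _ _ _ hmem (hp.m_edge 0 (by omega)).1
        rw [this] at hle
        exact hle.not_gt hpref1.2.2
      · by_cases hcb : c = β 1
        · exact .inl hcb
        · exact .inr (manPrefers_of_idxOf_le hec he1 hcb hle)
    have hat : I.AtLeast s (β 1) (α 1) 1 := by
      cases hst' : s.status (α 1)
      · exact h.both_rejected _ hst' _ he1 hbeyond
      · exact h.one_passed _ hst' _ he1 ⟨0, hbeyond 0⟩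
      · exact (hst hst').elim
    exact hnrej (AlgState.rejected_of_one_le_rank hbas (hat _ hi hge).2)

end SMInstance
end OneSidedTies

theorem theorem1 {A B : Type*} [Fintype A] [Fintype B] [DecidableEq A] [DecidableEq B]
    (I : SMInstance A B) (s : AlgState A B) (hs : I.IsFinal s)
    (M : Finset (A × B)) (hM : IsOutput s M)
    (OPT : Finset (A × B)) (hOPT : I.IsMaxStable OPT)
    (k : ℕ) (hk : 7 ≤ 2 * k + 1) (α : ℕ → A) (β : ℕ → B) (hpath : IsAugPath M OPT k α β) :
    ∃ i : ℕ, 1 ≤ i ∧ i ≤ k - 1 ∧ unpopularityCharge I s M OPT (β i) = 0 := by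
  refine ⟨1, le_rfl, by omega, ?_⟩
  by_contra hne
  obtain ⟨hcharge, hcrit⟩ := SMInstance.unpopularityCharge_ne_zero hne
  rcases SMInstance.charge3_ne_zero hcharge with ⟨α', β', hp', hless⟩ | ⟨b, hb⟩
  · exact hs.not_lessPreferredNeighbor hM hOPT.1 hpath (by omega) (hcrit _) hp' hless
  · exact hs.not_mJump hM hOPT.1 hpath (by omega) (hcrit _) b hb
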